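/- Let $\mathcal R_{II}$ be the set of complex symmetric matrices $\begin{pmatrix} z_{11}&z\\ z&z_{22}\end{pmatrix}$ of operator norm less than $1$ (with respect to the Euclidean norm of $\mathbb C^2$), and let the tetrablock $\mathbb E\subset\mathbb C^3$ be its image under $(z_{11},z_{22},z)\mapsto(z_{11},z_{22},z_{11}z_{22}-z^2)$. Let $\mathbb D$ be the open unit disc, and let $k_{\mathbb E}$ be the Kobayashi distance of $\mathbb E$, i.e. the largest pseudodistance on $\mathbb E$ not exceeding the Lempert function $$l_{\mathbb E}(z,w)=\inf\{\tanh^{-1}|\alpha| : \alpha\in\mathbb D,\ \exists\, f:\mathbb D\to\mathbb E \text{ holomorphic with } f(0)=z,\ f(\alpha)=w\}.$$ Then $k_{\mathbb E}$ is a (finite) distance on $\mathbb E$, and the metric space $(\mathbb E,k_{\mathbb E})$ is not Gromov hyperbolic: with $(x,y)_w=k_{\mathbb E}(x,w)+k_{\mathbb E}(w,y)-k_{\mathbb E}(x,y)$, $$\sup_{p,q,x,w\in\mathbb E}\big(\min\{(p,x)_w,(x,q)_w\}-(p,q)_w\big)=\infty .$$ -/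

import Mathlib

open scoped ENNReal

noncomputable section

/-- A pseudodistance on `X`, with values in `[0, ∞]`. -/
structure IsPseudodistance {X : Type*} (d : X → X → ℝ≥0∞) : Prop where
  self : ∀ x, d x x = 0
  symm : ∀ x y, d x y = d y x
  triangle : ∀ x y z, d x z ≤ d x y + d y z

/-- The Lempert function of `D`: the infimum of `artanh |α|` over all `α` in the open unit disc for
which there is a holomorphic map `f` from the unit disc to `D` with `f 0 = z` and `f α = w`
(it is `∞` when there is no such `α`). -/
def lempertFunction {V : Type*} [NormedAddCommGroup V] [NormedSpace ℂ V] (D : Set V)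
    (z w : D) : ℝ≥0∞ :=
  ⨅ (α : ℂ) (_ : α ∈ Metric.ball (0 : ℂ) 1)
    (_ : ∃ f : ℂ → V, DifferentiableOn ℂ f (Metric.ball 0 1) ∧
      Set.MapsTo f (Metric.ball 0 1) D ∧ f 0 = z ∧ f α = w),
    ENNReal.ofReal (Real.artanh ‖α‖)

/-- The Kobayashi distance of `D`: the largest pseudodistance on `D` that does not exceed the
Lempert function (see `isGreatest_kobayashiDist`). -/
def kobayashiDist {V : Type*} [NormedAddCommGroup V] [NormedSpace ℂ V] (D : Set V) :
    D → D → ℝ≥0∞ :=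
  sSup {d : D → D → ℝ≥0∞ | IsPseudodistance d ∧ ∀ z w, d z w ≤ lempertFunction D z w}

theorem isGreatest_kobayashiDist {V : Type*} [NormedAddCommGroup V] [NormedSpace ℂ V]
    (D : Set V) :
    IsGreatest {d : D → D → ℝ≥0∞ | IsPseudodistance d ∧ ∀ z w, d z w ≤ lempertFunction D z w}
      (kobayashiDist D) := by
  refine ⟨⟨⟨fun x => ?_, fun x y => ?_, fun x y z => ?_⟩, fun z w => ?_⟩, fun d hd => le_sSup hd⟩
  · simp only [kobayashiDist, sSup_apply, iSup_apply, ENNReal.iSup_eq_zero]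
    exact fun d => d.2.1.self x
  · simp only [kobayashiDist, sSup_apply, iSup_apply]
    exact iSup_congr fun d => d.2.1.symm x y
  · simp only [kobayashiDist, sSup_apply, iSup_apply]
    refine iSup_le fun d => (d.2.1.triangle x y z).trans (add_le_add ?_ ?_)
    · exact le_iSup (fun e : {d : D → D → ℝ≥0∞ |
        IsPseudodistance d ∧ ∀ z w, d z w ≤ lempertFunction D z w} => e.1 x y) d
    · exact le_iSup (fun e : {d : D → D → ℝ≥0∞ |
        IsPseudodistance d ∧ ∀ z w, d z w ≤ lempertFunction D z w} => e.1 y z) d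
  · simp only [kobayashiDist, sSup_apply, iSup_apply]
    exact iSup_le fun d => d.2.2 z w

/-- The Gromov product `(x, y)_z` (without the factor `1 / 2`). -/
def gromovProduct {X : Type*} (d : X → X → ℝ) (x y z : X) : ℝ :=
  d x z + d z y - d x y

/-- Gromov hyperbolicity of a space `X` with distance `d`:
`min {(p, x)_w, (x, q)_w} - (p, q)_w` is bounded above. -/
def IsGromovHyperbolic {X : Type*} (d : X → X → ℝ) : Prop :=
  ∃ C : ℝ, ∀ p q x w : X,
    min (gromovProduct d p x w) (gromovProduct d x q w) - gromovProduct d p q w ≤ C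

/-- The classical Cartan domain of the second type: symmetric complex `2 × 2` matrices of operator
norm less than `1` (with respect to the Euclidean norm of `ℂ²`). -/
def cartanDomainII : Set (Matrix (Fin 2) (Fin 2) ℂ) :=
  {Z | Z.transpose = Z ∧ ‖Matrix.toEuclideanCLM (𝕜 := ℂ) Z‖ < 1}

/-- The map `(z₁₁, z₂₂, z) ↦ (z₁₁, z₂₂, z₁₁ z₂₂ - z²)`, where `(z₁₁, z₂₂, z)` stands for the
symmetric matrix with diagonal entries `z₁₁`, `z₂₂` and off-diagonal entry `z`. -/
def tetrablockMap (Z : Matrix (Fin 2) (Fin 2) ℂ) : EuclideanSpace ℂ (Fin 3) :=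
  !₂[Z 0 0, Z 1 1, Z 0 0 * Z 1 1 - Z 0 1 ^ 2]

/-- The tetrablock. -/
def tetrablock : Set (EuclideanSpace ℂ (Fin 3)) :=
  tetrablockMap '' cartanDomainII

end

/-! A holomorphic retract of a domain inherits the Kobayashi distance of the domain. The tetrablock
retracts onto the bidisc `{(a, b, ab)}`, the image of the diagonal matrices, by `v ↦ (v₀, v₁)`, and
the Kobayashi distance of the bidisc is the maximum of two Poincaré distances. A pair of geodesics
in the factors is therefore an isometric copy of `ℝ × ℝ` with the sup metric, in which the points
`(t, t)`, `(t, -t)`, `(t, 0)` seen from the origin violate hyperbolicity as `t → ∞`.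

The discs `c ↦ tetrablockMap (c • Z)` join every point to the origin, so the distance is finite.
It separates points because the tetrablock is bounded: up to translation, every continuous linear
functional maps it into the upper half-plane, where the Schwarz–Pick lemma applies. That lemma is
used with the metric of `ℍ`, half of which is the Poincaré distance. -/

open Bornology Metric Set UpperHalfPlane
open scoped ComplexConjugate

section GromovHyperbolic

theorem IsGromovHyperbolic.comp {X Y : Type*} {d : Y → Y → ℝ} (h : IsGromovHyperbolic d)
    (f : X → Y) : IsGromovHyperbolic fun x y => d (f x) (f y) :=
  h.imp fun _ hC p q x w => hC (f p) (f q) (f x) (f w)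

theorem not_isGromovHyperbolic_dist_real_prod :
    ¬ IsGromovHyperbolic (dist : ℝ × ℝ → ℝ × ℝ → ℝ) := by
  rintro ⟨C, hC⟩
  set t : ℝ := |C| + 1
  have ht : 0 ≤ t := by positivity
  have h := hC (t, t) (t, -t) (t, 0) (0, 0)
  have h_two : |t + t| = t + t := abs_of_nonneg (by positivity)
  simp only [gromovProduct, Prod.dist_eq, Real.dist_eq, sub_self, sub_zero, zero_sub,
    zero_add, sub_neg_eq_add, abs_neg, abs_zero, abs_of_nonneg ht, h_two, max_self, max_eq_left ht,
    max_eq_right ht, max_eq_right (add_nonneg ht ht), min_self] at h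
  linarith [le_abs_self C]

end GromovHyperbolic

section KobayashiDist

variable {V W : Type*} [NormedAddCommGroup V] [NormedSpace ℂ V]
  [NormedAddCommGroup W] [NormedSpace ℂ W] {D : Set V} {E : Set W}

theorem IsPseudodistance.comp {X Y : Type*} {d : Y → Y → ℝ≥0∞} (hd : IsPseudodistance d)
    (f : X → Y) : IsPseudodistance fun x y => d (f x) (f y) :=
  ⟨fun _ => hd.self _, fun _ _ => hd.symm _ _, fun _ _ _ => hd.triangle _ _ _⟩

theorem isPseudodistance_kobayashiDist (D : Set V) : IsPseudodistance (kobayashiDist D) :=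
  (isGreatest_kobayashiDist D).1.1

theorem kobayashiDist_le_of_disc {R : ℝ} {f : ℂ → V} (hf : DifferentiableOn ℂ f (ball 0 R))
    (hD : MapsTo f (ball 0 R) D) {α : ℂ} (hα : ‖α‖ < R) {z w : D} (hz : f 0 = z)
    (hw : f α = w) : kobayashiDist D z w ≤ ENNReal.ofReal (Real.artanh (‖α‖ / R)) := by
  have hR : 0 < R := (norm_nonneg α).trans_lt hα
  have h_scale : MapsTo (fun c : ℂ => (R : ℂ) * c) (ball 0 1) (ball 0 R) := fun c hc => by
    rw [mem_ball_zero_iff] at hc ⊢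
    rw [norm_mul, Complex.norm_of_nonneg hR.le]
    exact mul_lt_of_lt_one_right hR hc
  have h_norm : ‖α / R‖ = ‖α‖ / R := by rw [norm_div, Complex.norm_of_nonneg hR.le]
  rw [← h_norm]
  refine ((isGreatest_kobayashiDist D).1.2 z w).trans
    (iInf₂_le_of_le (α / R) ?_ (iInf_le_of_le ⟨fun c => f (R * c), ?_, ?_, ?_, ?_⟩ le_rfl))
  · rwa [mem_ball_zero_iff, h_norm, div_lt_one hR]
  · exact hf.comp (differentiable_id.const_mul _).differentiableOn h_scale
  · exact hD.comp h_scale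
  · simpa only [mul_zero] using hz
  · simpa only [mul_div_cancel₀ α (Complex.ofReal_ne_zero.2 hR.ne')] using hw

theorem le_kobayashiDist {d : D → D → ℝ≥0∞} (hd : IsPseudodistance d)
    (h_disc : ∀ f : ℂ → V, DifferentiableOn ℂ f (ball 0 1) → ∀ hD : MapsTo f (ball 0 1) D,
      ∀ α (hα : α ∈ ball (0 : ℂ) 1),
        d ⟨f 0, hD (mem_ball_self one_pos)⟩ ⟨f α, hD hα⟩ ≤ ENNReal.ofReal (Real.artanh ‖α‖))
    (z w : D) : d z w ≤ kobayashiDist D z w := by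
  refine (isGreatest_kobayashiDist D).2 ⟨hd, fun z w => ?_⟩ z w
  refine le_iInf₂ fun α hα => le_iInf fun ⟨f, hf, hD, hz, hw⟩ => ?_
  obtain rfl : z = ⟨f 0, hD (mem_ball_self one_pos)⟩ := Subtype.ext hz.symm
  obtain rfl : w = ⟨f α, hD hα⟩ := Subtype.ext hw.symm
  exact h_disc f hf hD α hα

theorem kobayashiDist_map_le {F : V → W} (hF : DifferentiableOn ℂ F D) (hDE : MapsTo F D E)
    (z w : D) : kobayashiDist E ⟨F z, hDE z.2⟩ ⟨F w, hDE w.2⟩ ≤ kobayashiDist D z w :=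
  le_kobayashiDist ((isPseudodistance_kobayashiDist E).comp fun v : D => ⟨F v, hDE v.2⟩)
    (fun f hf hD α hα => by
      simpa only [div_one] using kobayashiDist_le_of_disc (hF.comp hf hD) (hDE.comp hD)
        (mem_ball_zero_iff.1 hα) rfl rfl) z w

theorem kobayashiDist_eq_of_leftInvOn {ι : V → W} {π : W → V} (hι : DifferentiableOn ℂ ι D)
    (hDE : MapsTo ι D E) (hπ : DifferentiableOn ℂ π E) (hED : MapsTo π E D)
    (h_inv : LeftInvOn π ι D) (z w : D) :
    kobayashiDist E ⟨ι z, hDE z.2⟩ ⟨ι w, hDE w.2⟩ = kobayashiDist D z w := by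
  refine (kobayashiDist_map_le hι hDE z w).antisymm ?_
  simpa only [h_inv z.2, h_inv w.2, Subtype.coe_eta] using
    kobayashiDist_map_le hπ hED ⟨ι z, hDE z.2⟩ ⟨ι w, hDE w.2⟩

end KobayashiDist

section HalfPlane

/-- The Cayley transform `ℍ → 𝔻` centred at `z`: the biholomorphism that sends `z` to `0`. -/
noncomputable def halfPlaneToDisc (z w : ℂ) : ℂ :=
  (w - z) / (w - conj z)

/-- The inverse `𝔻 → ℍ` of the Cayley transform `halfPlaneToDisc z`. -/
noncomputable def discToHalfPlane (z ξ : ℂ) : ℂ :=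
  (z - conj z * ξ) / (1 - ξ)

theorem sub_conj_ne_zero {z w : ℂ} (hz : 0 < z.im) (hw : 0 < w.im) : w - conj z ≠ 0 := fun h => by
  have h_im : w.im + z.im = 0 := by simpa using congrArg Complex.im h
  linarith

theorem one_sub_ne_zero_of_norm_lt_one {ξ : ℂ} (hξ : ‖ξ‖ < 1) : 1 - ξ ≠ 0 := by
  intro h
  simp [← sub_eq_zero.1 h] at hξ

theorem norm_halfPlaneToDisc (z w : ℍ) :
    ‖halfPlaneToDisc z w‖ = Real.tanh (dist z w / 2) := by
  rw [dist_comm z w, tanh_half_dist, halfPlaneToDisc, norm_div, dist_eq_norm, dist_eq_norm]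

theorem mapsTo_halfPlaneToDisc {z : ℂ} (hz : 0 < z.im) :
    MapsTo (halfPlaneToDisc z) upperHalfPlaneSet (ball 0 1) := fun w hw => by
  rw [mem_ball_zero_iff, norm_halfPlaneToDisc ⟨z, hz⟩ ⟨w, hw⟩]
  exact Real.tanh_lt_one _

theorem differentiableOn_halfPlaneToDisc {z : ℂ} (hz : 0 < z.im) :
    DifferentiableOn ℂ (halfPlaneToDisc z) upperHalfPlaneSet :=
  (differentiableOn_id.sub_const z).div (differentiableOn_id.sub_const _)
    fun _ hw => sub_conj_ne_zero hz hw

theorem mapsTo_discToHalfPlane {z : ℂ} (hz : 0 < z.im) :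
    MapsTo (discToHalfPlane z) (ball 0 1) upperHalfPlaneSet := fun ξ hξ => by
  rw [mem_ball_zero_iff] at hξ
  have h_sq : ξ.re * ξ.re + ξ.im * ξ.im < 1 := by
    rw [← Complex.normSq_apply, ← Complex.sq_norm]
    exact pow_lt_one₀ (norm_nonneg _) hξ two_ne_zero
  have h_im : (discToHalfPlane z ξ).im
      = z.im * (1 - (ξ.re * ξ.re + ξ.im * ξ.im)) / Complex.normSq (1 - ξ) := by
    rw [discToHalfPlane, Complex.div_im, ← sub_div]
    simp only [Complex.sub_im, Complex.mul_im, Complex.conj_re, Complex.conj_im, neg_mul,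
      Complex.sub_re, Complex.one_re, Complex.mul_re, sub_neg_eq_add, Complex.one_im, zero_sub,
      mul_neg]
    ring
  rw [mem_ofPred_eq, h_im]
  exact div_pos (mul_pos hz (sub_pos.2 h_sq))
    (Complex.normSq_pos.2 (one_sub_ne_zero_of_norm_lt_one hξ))

theorem differentiableOn_discToHalfPlane (z : ℂ) :
    DifferentiableOn ℂ (discToHalfPlane z) (ball 0 1) :=
  ((differentiableOn_id.const_mul _).const_sub z).div (differentiableOn_id.const_sub 1)
    fun _ hξ => one_sub_ne_zero_of_norm_lt_one (mem_ball_zero_iff.1 hξ)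

theorem invOn_discToHalfPlane {z : ℂ} (hz : 0 < z.im) :
    InvOn (discToHalfPlane z) (halfPlaneToDisc z) upperHalfPlaneSet (ball 0 1) := by
  refine ⟨fun w hw => ?_, fun ξ hξ => ?_⟩
  · have hw' := sub_conj_ne_zero hz hw
    have h_sub : 1 - halfPlaneToDisc z w ≠ 0 :=
      one_sub_ne_zero_of_norm_lt_one (mem_ball_zero_iff.1 (mapsTo_halfPlaneToDisc hz hw))
    rw [discToHalfPlane, div_eq_iff h_sub, halfPlaneToDisc]
    field_simp
    ring
  · have hξ' := one_sub_ne_zero_of_norm_lt_one (mem_ball_zero_iff.1 hξ)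
    have h_sub : discToHalfPlane z ξ - conj z ≠ 0 :=
      sub_conj_ne_zero hz (mapsTo_discToHalfPlane hz hξ)
    rw [halfPlaneToDisc, div_eq_iff h_sub, discToHalfPlane]
    field_simp
    ring

theorem dist_le_two_mul_artanh {f : ℂ → ℂ} (hf : DifferentiableOn ℂ f (ball 0 1))
    (hU : MapsTo f (ball 0 1) upperHalfPlaneSet) {α : ℂ} (hα : α ∈ ball (0 : ℂ) 1) :
    dist (⟨f 0, hU (mem_ball_self one_pos)⟩ : ℍ) ⟨f α, hU hα⟩ ≤ 2 * Real.artanh ‖α‖ := by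
  have h0 : 0 < (f 0).im := hU (mem_ball_self one_pos)
  have hα1 : ‖α‖ < 1 := mem_ball_zero_iff.1 hα
  have h_schwarz : ‖halfPlaneToDisc (f 0) (f α)‖ ≤ ‖α‖ :=
    Complex.norm_le_norm_of_mapsTo_ball (f := halfPlaneToDisc (f 0) ∘ f)
      ((differentiableOn_halfPlaneToDisc h0).comp hf hU)
      (((mapsTo_halfPlaneToDisc h0).comp hU).mono_right ball_subset_closedBall)
      (by simp [halfPlaneToDisc]) hα1
  rw [norm_halfPlaneToDisc ⟨f 0, h0⟩ ⟨f α, hU hα⟩] at h_schwarz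
  have h_artanh := Real.artanh_le_artanh (Real.neg_one_lt_tanh _) hα1 h_schwarz
  rw [Real.artanh_tanh] at h_artanh
  linarith

theorem ofReal_dist_div_two_le_kobayashiDist (z w : upperHalfPlaneSet) :
    ENNReal.ofReal (dist (⟨z, z.2⟩ : ℍ) ⟨w, w.2⟩ / 2) ≤ kobayashiDist upperHalfPlaneSet z w := by
  have h_pseudo : IsPseudodistance fun z w : ℍ => ENNReal.ofReal (dist z w / 2) :=
    ⟨fun z => by simp, fun z w => by rw [dist_comm], fun x y z => by
      rw [← ENNReal.ofReal_add (by positivity) (by positivity)]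
      exact ENNReal.ofReal_le_ofReal (by linarith [dist_triangle x y z])⟩
  refine le_kobayashiDist (h_pseudo.comp fun z : upperHalfPlaneSet => ⟨z, z.2⟩)
    (fun f hf hU α hα => ENNReal.ofReal_le_ofReal ?_) z w
  linarith [dist_le_two_mul_artanh hf hU hα]

/-- The point of the domain `ℍ × ℍ` in `ℂ × ℂ` given by a pair of elements of the type `ℍ`, which
carries the hyperbolic metric. -/
def halfPlaneProdMk (z : ℍ × ℍ) : (upperHalfPlaneSet ×ˢ upperHalfPlaneSet : Set (ℂ × ℂ)) :=
  ⟨(↑z.1, ↑z.2), z.1.im_pos, z.2.im_pos⟩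

theorem ofReal_dist_div_two_le_kobayashiDist_prod (z w : ℍ × ℍ) :
    ENNReal.ofReal (dist z w / 2) ≤ kobayashiDist (upperHalfPlaneSet ×ˢ upperHalfPlaneSet)
      (halfPlaneProdMk z) (halfPlaneProdMk w) := by
  have h_fst : MapsTo Prod.fst (upperHalfPlaneSet ×ˢ upperHalfPlaneSet) upperHalfPlaneSet :=
    fun _ hv => hv.1
  have h_snd : MapsTo Prod.snd (upperHalfPlaneSet ×ˢ upperHalfPlaneSet) upperHalfPlaneSet :=
    fun _ hv => hv.2
  rw [Prod.dist_eq, ← max_div_div_right zero_le_two, ENNReal.ofReal_max]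
  refine max_le ?_ ?_
  · exact (ofReal_dist_div_two_le_kobayashiDist ⟨z.1, z.1.im_pos⟩ ⟨w.1, w.1.im_pos⟩).trans
      (kobayashiDist_map_le differentiableOn_fst h_fst (halfPlaneProdMk z) (halfPlaneProdMk w))
  · exact (ofReal_dist_div_two_le_kobayashiDist ⟨z.2, z.2.im_pos⟩ ⟨w.2, w.2.im_pos⟩).trans
      (kobayashiDist_map_le differentiableOn_snd h_snd (halfPlaneProdMk z) (halfPlaneProdMk w))

theorem monotone_tanh : Monotone Real.tanh := fun s t h => by
  rw [← Real.artanh_le_artanh_iff ⟨Real.neg_one_lt_tanh s, Real.tanh_lt_one s⟩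
    ⟨Real.neg_one_lt_tanh t, Real.tanh_lt_one t⟩]
  rwa [Real.artanh_tanh, Real.artanh_tanh]

theorem exists_disc_of_dist_le {z w : ℍ} {t : ℝ} (h : dist z w ≤ 2 * t) :
    ∃ f : ℂ → ℂ, DifferentiableOn ℂ f (ball 0 1) ∧ MapsTo f (ball 0 1) upperHalfPlaneSet ∧
      f 0 = z ∧ f (Real.tanh t) = w := by
  -- If `tanh t = 0`, then `z = w` and `c` is the junk value `0`.
  set c : ℂ := halfPlaneToDisc z w / Real.tanh t
  have h_le : ‖halfPlaneToDisc z w‖ ≤ ‖(Real.tanh t : ℂ)‖ := by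
    rw [norm_halfPlaneToDisc, Complex.norm_real]
    exact (monotone_tanh (by linarith)).trans (le_abs_self _)
  have hc : ‖c‖ ≤ 1 := by
    rw [norm_div]
    exact div_le_one_of_le₀ h_le (norm_nonneg _)
  have hct : c * Real.tanh t = halfPlaneToDisc z w :=
    div_mul_cancel_of_imp fun h0 => by simpa [h0] using h_le
  have h_ball : MapsTo (fun ξ : ℂ => c * ξ) (ball 0 1) (ball 0 1) := fun ξ hξ => by
    rw [mem_ball_zero_iff] at hξ ⊢
    rw [norm_mul]
    exact mul_lt_one_of_nonneg_of_lt_one_right hc (norm_nonneg _) hξ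
  refine ⟨fun ξ => discToHalfPlane z (c * ξ),
    (differentiableOn_discToHalfPlane z).comp (differentiable_id.const_mul c).differentiableOn
      h_ball, (mapsTo_discToHalfPlane z.im_pos).comp h_ball, by simp [discToHalfPlane], ?_⟩
  beta_reduce
  rw [hct]
  exact (invOn_discToHalfPlane z.im_pos).1 w.im_pos

theorem kobayashiDist_upperHalfPlaneSet_prod (z w : ℍ × ℍ) :
    kobayashiDist (upperHalfPlaneSet ×ˢ upperHalfPlaneSet) (halfPlaneProdMk z)
      (halfPlaneProdMk w) = ENNReal.ofReal (dist z w / 2) := by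
  apply le_antisymm
  · have ht : dist z w = 2 * (dist z w / 2) := by ring
    obtain ⟨f, hf, hfU, hf0, hf1⟩ := exists_disc_of_dist_le ((le_max_left _ _).trans_eq ht)
    obtain ⟨g, hg, hgU, hg0, hg1⟩ := exists_disc_of_dist_le ((le_max_right _ _).trans_eq ht)
    have h_tanh : ‖(Real.tanh (dist z w / 2) : ℂ)‖ = Real.tanh (dist z w / 2) :=
      Complex.norm_of_nonneg (Real.tanh_zero ▸ monotone_tanh (by positivity))
    have h_disc := kobayashiDist_le_of_disc (α := Real.tanh (dist z w / 2)) (hf.prodMk hg)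
      (fun _ hξ => mk_mem_prod (hfU hξ) (hgU hξ)) (by rw [h_tanh]; exact Real.tanh_lt_one _)
      (z := halfPlaneProdMk z) (w := halfPlaneProdMk w) (Prod.ext hf0 hg0) (Prod.ext hf1 hg1)
    rwa [div_one, h_tanh, Real.artanh_tanh] at h_disc
  · exact ofReal_dist_div_two_le_kobayashiDist_prod z w

end HalfPlane

section Criteria

variable {V : Type*} [NormedAddCommGroup V] [NormedSpace ℂ V] {D : Set V}

theorem eq_of_kobayashiDist_eq_zero (hD : IsBounded D) {z w : D} (h : kobayashiDist D z w = 0) :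
    z = w := by
  refine Subtype.ext ((SeparatingDual.eq_iff_forall_dual_eq (R := ℂ)).2 fun g => ?_)
  obtain ⟨M, hM⟩ := (g.lipschitz.isBounded_image hD).subset_ball 0
  have h_maps : MapsTo (fun v => g v + M * Complex.I) D upperHalfPlaneSet := fun v hv => by
    have h_norm : ‖g v‖ < M := mem_ball_zero_iff.1 (hM (mem_image_of_mem g hv))
    have h_im := (abs_le.1 (Complex.abs_im_le_norm (g v))).1
    simp only [mem_ofPred_eq, Complex.add_im, Complex.im_ofReal_mul, Complex.I_im, mul_one]
    linarith
  have h_le := (ofReal_dist_div_two_le_kobayashiDist _ _).trans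
    (kobayashiDist_map_le (g.differentiable.differentiableOn.add_const _) h_maps z w)
  rw [h, nonpos_iff_eq_zero, ENNReal.ofReal_eq_zero] at h_le
  have h_eq := dist_le_zero.1 (show dist _ _ ≤ (0 : ℝ) by linarith)
  exact add_right_cancel (congrArg UpperHalfPlane.coe h_eq)

theorem not_isGromovHyperbolic_of_leftInvOn_halfPlane_prod {ι : ℂ × ℂ → V} {π : V → ℂ × ℂ}
    (hι : DifferentiableOn ℂ ι (upperHalfPlaneSet ×ˢ upperHalfPlaneSet))
    (hιD : MapsTo ι (upperHalfPlaneSet ×ˢ upperHalfPlaneSet) D) (hπ : DifferentiableOn ℂ π D)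
    (hπD : MapsTo π D (upperHalfPlaneSet ×ˢ upperHalfPlaneSet))
    (h_inv : LeftInvOn π ι (upperHalfPlaneSet ×ˢ upperHalfPlaneSet)) :
    ¬ IsGromovHyperbolic fun z w : D => (kobayashiDist D z w).toReal := by
  -- Two vertical geodesics give an isometric embedding of the sup metric on the plane.
  obtain ⟨γ, hγ⟩ : ∃ γ : ℝ × ℝ → ℍ × ℍ, Isometry γ :=
    ⟨_, (isometry_vertical_line 0).prodMap (isometry_vertical_line 0)⟩
  intro h
  apply not_isGromovHyperbolic_dist_real_prod
  convert h.comp fun a : ℝ × ℝ => (⟨ι (halfPlaneProdMk (γ ((2 : ℝ) • a))),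
    hιD (halfPlaneProdMk (γ ((2 : ℝ) • a))).2⟩ : D) with a b
  have h_dist : dist (γ ((2 : ℝ) • a)) (γ ((2 : ℝ) • b)) = 2 * dist a b := by
    rw [hγ.dist_eq, dist_smul₀, Real.norm_of_nonneg zero_le_two]
  have h_eq := (kobayashiDist_eq_of_leftInvOn hι hιD hπ hπD h_inv _ _).trans
    (kobayashiDist_upperHalfPlaneSet_prod (γ ((2 : ℝ) • a)) (γ ((2 : ℝ) • b)))
  rw [h_eq, h_dist, mul_div_cancel_left₀ _ two_ne_zero, ENNReal.toReal_ofReal dist_nonneg]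

theorem differentiableOn_prodMap {𝕜 E₁ E₂ F₁ F₂ : Type*} [NontriviallyNormedField 𝕜]
    [NormedAddCommGroup E₁] [NormedSpace 𝕜 E₁] [NormedAddCommGroup E₂] [NormedSpace 𝕜 E₂]
    [NormedAddCommGroup F₁] [NormedSpace 𝕜 F₁] [NormedAddCommGroup F₂] [NormedSpace 𝕜 F₂]
    {f : E₁ → F₁} {g : E₂ → F₂} {s : Set E₁} {t : Set E₂} (hf : DifferentiableOn 𝕜 f s)
    (hg : DifferentiableOn 𝕜 g t) : DifferentiableOn 𝕜 (Prod.map f g) (s ×ˢ t) :=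
  (hf.comp differentiableOn_fst fun _ h => h.1).prodMk
    (hg.comp differentiableOn_snd fun _ h => h.2)

theorem not_isGromovHyperbolic_of_leftInvOn_bidisc {ι : ℂ × ℂ → V} {π : V → ℂ × ℂ}
    (hι : DifferentiableOn ℂ ι (ball 0 1 ×ˢ ball 0 1)) (hιD : MapsTo ι (ball 0 1 ×ˢ ball 0 1) D)
    (hπ : DifferentiableOn ℂ π D) (hπD : MapsTo π D (ball 0 1 ×ˢ ball 0 1))
    (h_inv : LeftInvOn π ι (ball 0 1 ×ˢ ball 0 1)) :
    ¬ IsGromovHyperbolic fun z w : D => (kobayashiDist D z w).toReal := by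
  have h_disc := mapsTo_halfPlaneToDisc I.im_pos
  have h_halfPlane := mapsTo_discToHalfPlane I.im_pos
  have h_diff := differentiableOn_halfPlaneToDisc I.im_pos
  have h_diff' := differentiableOn_discToHalfPlane Complex.I
  have h_left := (invOn_discToHalfPlane I.im_pos).1
  exact not_isGromovHyperbolic_of_leftInvOn_halfPlane_prod
    (hι.comp (differentiableOn_prodMap h_diff h_diff) (h_disc.prodMap h_disc))
    (hιD.comp (h_disc.prodMap h_disc))
    ((differentiableOn_prodMap h_diff' h_diff').comp hπ hπD)
    ((h_halfPlane.prodMap h_halfPlane).comp hπD)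
    ((h_left.prodMap h_left).comp h_inv (h_disc.prodMap h_disc))

end Criteria

section Tetrablock

theorem norm_apply_le_norm_toEuclideanCLM {𝕜 n : Type*} [RCLike 𝕜] [Fintype n] [DecidableEq n]
    (A : Matrix n n 𝕜) (i j : n) : ‖A i j‖ ≤ ‖Matrix.toEuclideanCLM (𝕜 := 𝕜) A‖ :=
  calc ‖A i j‖ = ‖Matrix.toEuclideanCLM (𝕜 := 𝕜) A (EuclideanSpace.single j 1) i‖ := by
        simp [Matrix.ofLp_toEuclideanCLM]
    _ ≤ ‖Matrix.toEuclideanCLM (𝕜 := 𝕜) A (EuclideanSpace.single j 1)‖ := PiLp.norm_apply_le _ i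
    _ ≤ ‖Matrix.toEuclideanCLM (𝕜 := 𝕜) A‖ := by
        simpa using (Matrix.toEuclideanCLM (𝕜 := 𝕜) A).le_opNorm (EuclideanSpace.single j 1)

theorem norm_apply_lt_one_of_mem_cartanDomainII {Z : Matrix (Fin 2) (Fin 2) ℂ}
    (hZ : Z ∈ cartanDomainII) (i j : Fin 2) : ‖Z i j‖ < 1 :=
  (norm_apply_le_norm_toEuclideanCLM Z i j).trans_lt hZ.2

theorem diagonal_mem_cartanDomainII {a b : ℂ} (ha : ‖a‖ < 1) (hb : ‖b‖ < 1) :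
    Matrix.diagonal ![a, b] ∈ cartanDomainII := by
  refine ⟨Matrix.diagonal_transpose _, (Matrix.l2_opNorm_diagonal ![a, b]).trans_lt ?_⟩
  rw [pi_norm_lt_iff one_pos, Fin.forall_fin_two]
  exact ⟨ha, hb⟩

theorem differentiableOn_tetrablockMap_comp {V : Type*} [NormedAddCommGroup V] [NormedSpace ℂ V]
    {s : Set V} {M : V → Matrix (Fin 2) (Fin 2) ℂ}
    (hM : ∀ i j, DifferentiableOn ℂ (fun v => M v i j) s) :
    DifferentiableOn ℂ (fun v => tetrablockMap (M v)) s := by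
  rw [differentiableOn_euclidean]
  intro i
  fin_cases i
  · exact hM 0 0
  · exact hM 1 1
  · exact ((hM 0 0).mul (hM 1 1)).sub ((hM 0 1).pow 2)

theorem isBounded_tetrablock : IsBounded tetrablock := by
  refine ((PiLp.antilipschitzWith_ofLp 2 _).isBounded_preimage
    (isBounded_closedBall (x := (0 : Fin 3 → ℂ)) (r := 2))).subset ?_
  rintro _ ⟨Z, hZ, rfl⟩
  have h_entry i j : ‖Z i j‖ ≤ 1 := (norm_apply_lt_one_of_mem_cartanDomainII hZ i j).le
  rw [mem_preimage, mem_closedBall_zero_iff, pi_norm_le_iff_of_nonneg zero_le_two,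
    Fin.forall_fin_succ, Fin.forall_fin_two]
  refine ⟨(h_entry 0 0).trans one_le_two, (h_entry 1 1).trans one_le_two, ?_⟩
  calc ‖Z 0 0 * Z 1 1 - Z 0 1 ^ 2‖ ≤ ‖Z 0 0‖ * ‖Z 1 1‖ + ‖Z 0 1‖ ^ 2 :=
        (norm_sub_le _ _).trans_eq (by rw [norm_mul, norm_pow])
    _ ≤ 1 * 1 + 1 ^ 2 := by gcongr <;> exact h_entry _ _
    _ = 2 := by norm_num

theorem exists_kobayashiDist_tetrablock_ne_top :
    ∃ o : tetrablock, ∀ z, kobayashiDist tetrablock o z ≠ ⊤ := by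
  refine ⟨⟨tetrablockMap 0, 0, ⟨by simp, by simp⟩, rfl⟩, ?_⟩
  rintro ⟨_, Z, ⟨h_symm, h_norm⟩, rfl⟩
  obtain ⟨s, hs, hs1⟩ := exists_between h_norm
  have hs0 : 0 < s := (norm_nonneg _).trans_lt hs
  have h_maps : MapsTo (fun c : ℂ => tetrablockMap (c • Z)) (ball 0 s⁻¹) tetrablock :=
    fun c hc => by
    refine ⟨c • Z, ⟨by rw [Matrix.transpose_smul, h_symm], ?_⟩, rfl⟩
    rw [map_smul, norm_smul]
    calc ‖c‖ * ‖Matrix.toEuclideanCLM (𝕜 := ℂ) Z‖ < s⁻¹ * s :=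
          mul_lt_mul'' (mem_ball_zero_iff.1 hc) hs (norm_nonneg _) (norm_nonneg _)
      _ = 1 := inv_mul_cancel₀ hs0.ne'
  exact ne_top_of_le_ne_top ENNReal.ofReal_ne_top (kobayashiDist_le_of_disc (α := 1)
    (differentiableOn_tetrablockMap_comp (M := fun c : ℂ => c • Z) fun i j =>
      (differentiable_id.mul_const (Z i j)).differentiableOn)
    h_maps (by simpa using (one_lt_inv₀ hs0).2 hs1) (by simp only [zero_smul])
    (by simp only [one_smul]))

theorem kobayashiDist_tetrablock_ne_top (z w : tetrablock) : kobayashiDist tetrablock z w ≠ ⊤ := by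
  obtain ⟨o, ho⟩ := exists_kobayashiDist_tetrablock_ne_top
  have h_pseudo := isPseudodistance_kobayashiDist tetrablock
  exact ne_top_of_le_ne_top (ENNReal.add_ne_top.2 ⟨h_pseudo.symm z o ▸ ho z, ho w⟩)
    (h_pseudo.triangle z o w)

theorem not_isGromovHyperbolic_tetrablock :
    ¬ IsGromovHyperbolic fun z w : tetrablock => (kobayashiDist tetrablock z w).toReal := by
  refine not_isGromovHyperbolic_of_leftInvOn_bidisc
    (ι := fun a => tetrablockMap (Matrix.diagonal ![a.1, a.2])) (π := fun v => (v 0, v 1))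
    (differentiableOn_tetrablockMap_comp fun i j => ?_) ?_ (by fun_prop) ?_ ?_
  · fin_cases i <;> fin_cases j
    exacts [differentiableOn_fst, differentiableOn_const 0, differentiableOn_const 0,
      differentiableOn_snd]
  · exact fun a ha => mem_image_of_mem _ (diagonal_mem_cartanDomainII
      (mem_ball_zero_iff.1 ha.1) (mem_ball_zero_iff.1 ha.2))
  · rintro _ ⟨Z, hZ, rfl⟩
    exact ⟨mem_ball_zero_iff.2 (norm_apply_lt_one_of_mem_cartanDomainII hZ 0 0),
      mem_ball_zero_iff.2 (norm_apply_lt_one_of_mem_cartanDomainII hZ 1 1)⟩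
  · intro a _
    simp [tetrablockMap]

end Tetrablock

/-- The Kobayashi distance of the tetrablock is a (finite) distance, and the tetrablock with this
distance is not Gromov hyperbolic. -/
theorem proposition4 :
    (∀ z w : tetrablock, kobayashiDist tetrablock z w ≠ ⊤) ∧
    (∀ z w : tetrablock, kobayashiDist tetrablock z w = 0 → z = w) ∧
    ¬ IsGromovHyperbolic (fun z w : tetrablock => (kobayashiDist tetrablock z w).toReal) :=
  ⟨kobayashiDist_tetrablock_ne_top, fun _ _ => eq_of_kobayashiDist_eq_zero isBounded_tetrablock,
    not_isGromovHyperbolic_tetrablock⟩
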